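/- Let $\mathcal A$ be a complex unital Banach algebra with $\|1_{\mathcal A}\|=1$, let $\mathbb D$ be the open unit disk in $\mathbb C$, and let $\{F_t\}_{t\ge 0}$ be a one-parameter continuous semigroup of holomorphic self-mappings of $\mathbb D$ (jointly continuous in $(t,z)\in[0,\infty)\times\mathbb D$, with $F_{t+s}=F_t\circ F_s$ and $F_0=\mathrm{id}$). Let $f\in\mathrm{Hol}(\mathbb D,\mathbb C)$, $f(z)=\lim_{t\to0^+}(F_t(z)-z)/t$, be its generator, and assume that $f(z_0)=0$ for some $z_0\in\mathbb D$ and that $\lambda:=-f'(z_0)$ satisfies $\operatorname{Re}\lambda>0$. Then there is a Kœnigs function of the semigroup, that is, a univalent function $h\in\mathrm{Hol}(\mathbb D,\mathbb C)$ with $$h(F_t(z))=e^{-\lambda t}h(z)\quad(t\ge 0,\ z\in\mathbb D),\qquad h(z_0)=0,\qquad h'(z_0)=1.$$ Let $B\in\mathrm{Hol}(\mathbb D,\mathcal A)$, put $B_0=B(z_0)$, let $h$ be the Kœnigs function, and let $b_k\in\mathcal A$ be the Taylor coefficients at $0$ of $B\circ h^{-1}$, so that $B(h^{-1}(w))=B_0+\sum_{k\ge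 1}b_kw^k$ near $w=0$. Let $\{\Gamma_t\}_{t\ge 0}$ be the semicocycle over $\{F_t\}_{t\ge0}$ generated by $B$; that is, $\Gamma_t\in\mathrm{Hol}(\mathbb D,\mathcal A)$, $(t,z)\mapsto\Gamma_t(z)$ is continuous, $\Gamma_t(F_s(z))\Gamma_s(z)=\Gamma_{t+s}(z)$, and $$\frac{d}{dt}\Gamma_t(z)=B(F_t(z))\Gamma_t(z),\qquad \Gamma_0(z)=1_{\mathcal A}\qquad(t,s\ge 0,\ z\in\mathbb D).$$ Then $\{\Gamma_t\}_{t\ge0}$ is linearizable, i.e. there are $C\in\mathcal A$ and a holomorphic mapping $M$ from $\mathbb D$ into the set of invertible elements of $\mathcal A$ such that $$\Gamma_t(z)=M(F_t(z))^{-1}e^{tC}M(z)\qquad\text{for all } t\ge 0,\ z\in\mathbb D,$$ if and only if there is a sequence $(m_k)_{k\ge 0}$ in $\mathcal A$ with $m_0=1_{\mathcal A}$ and $$k\lambda\, m_k-(m_kB_0-B_0m_k)=\sum_{l=0}^{k-1}m_l\,b_{k-l}\qquad\text{for all } k\ge 0.$$ -/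

import Mathlib

open Set Filter Topology

noncomputable section

/-- The open unit disk of the complex plane. -/
abbrev unitDisk : Set ℂ := Metric.ball (0 : ℂ) 1

/-- One-parameter continuous semigroups of holomorphic self-mappings of the unit disk.
Only the values `F t z` with `0 ≤ t` and `z ∈ unitDisk` are relevant. -/
structure IsHolSemigroup (F : ℝ → ℂ → ℂ) : Prop where
  holomorphic : ∀ t, 0 ≤ t → DifferentiableOn ℂ (F t) unitDisk
  mapsTo : ∀ t, 0 ≤ t → MapsTo (F t) unitDisk unitDisk
  continuous : ContinuousOn (fun p : ℝ × ℂ => F p.1 p.2) (Ici (0 : ℝ) ×ˢ unitDisk)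
  add : ∀ t s, 0 ≤ t → 0 ≤ s → ∀ z ∈ unitDisk, F (t + s) z = F t (F s z)
  zero : ∀ z ∈ unitDisk, F 0 z = z

/-- `f ∈ Hol(𝔻, ℂ)` is the infinitesimal generator of the semigroup `F`. -/
structure IsSemigroupGenerator (F : ℝ → ℂ → ℂ) (f : ℂ → ℂ) : Prop where
  holomorphic : DifferentiableOn ℂ f unitDisk
  tendsto : ∀ z ∈ unitDisk,
    Tendsto (fun t : ℝ => (F t z - z) / (t : ℂ)) (𝓝[>] (0 : ℝ)) (𝓝 (f z))

/-- `h` is the Kœnigs function of the semigroup `F` at the interior fixed point `z₀`,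
where `lam = -f'(z₀)` for the generator `f` of `F`. -/
structure IsKoenigsFunction (F : ℝ → ℂ → ℂ) (z₀ lam : ℂ) (h : ℂ → ℂ) : Prop where
  holomorphic : DifferentiableOn ℂ h unitDisk
  univalent : InjOn h unitDisk
  schroeder : ∀ t : ℝ, 0 ≤ t → ∀ z ∈ unitDisk, h (F t z) = Complex.exp (-lam * t) * h z
  map_fixed : h z₀ = 0
  deriv_fixed : deriv h z₀ = 1

section Algebra

variable {A : Type*} [NormedRing A] [NormedAlgebra ℂ A]

/-- Holomorphic `A`-valued semicocycles over the semigroup `F`. -/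
structure IsSemicocycle (F : ℝ → ℂ → ℂ) (Γ : ℝ → ℂ → A) : Prop where
  holomorphic : ∀ t, 0 ≤ t → DifferentiableOn ℂ (Γ t) unitDisk
  continuous : ContinuousOn (fun p : ℝ × ℂ => Γ p.1 p.2) (Ici (0 : ℝ) ×ˢ unitDisk)
  chain : ∀ t s, 0 ≤ t → 0 ≤ s → ∀ z ∈ unitDisk, Γ t (F s z) * Γ s z = Γ (t + s) z
  zero : ∀ z ∈ unitDisk, Γ 0 z = 1

/-- `Γ` is generated by `B`: it solves `dΓ_t(z)/dt = B(F_t(z)) Γ_t(z)`, `Γ_0(z) = 1`,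
for `t ≥ 0` and `z` in the disk (with the right derivative at `t = 0`). -/
def IsSemicocycleGeneratedBy (F : ℝ → ℂ → ℂ) (Γ : ℝ → ℂ → A) (B : ℂ → A) : Prop :=
  ∀ z ∈ unitDisk, Γ 0 z = 1 ∧
    ∀ t : ℝ, 0 ≤ t →
      HasDerivWithinAt (fun s : ℝ => Γ s z) (B (F t z) * Γ t z) (Ici (0 : ℝ)) t

/-- `Γ_t(z) = M(F_t(z))⁻¹ e^{tC} M(z)` for some `C ∈ A` and some holomorphic mapping `M` of the
disk into the group of invertible elements of `A`. -/
def IsLinearizable (F : ℝ → ℂ → ℂ) (Γ : ℝ → ℂ → A) : Prop :=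
  ∃ (C : A) (M : ℂ → A), DifferentiableOn ℂ M unitDisk ∧ (∀ z ∈ unitDisk, IsUnit (M z)) ∧
    ∀ t : ℝ, 0 ≤ t → ∀ z ∈ unitDisk,
      Γ t z = Ring.inverse (M (F t z)) * NormedSpace.exp ((t : ℂ) • C) * M z

/-- The `k`-th Taylor coefficient at `0` of `B ∘ h⁻¹`, where `h⁻¹ : h(𝔻) → 𝔻` is the inverse of
the univalent function `h` on the disk. -/
def koenigsCoeff (B : ℂ → A) (h : ℂ → ℂ) (k : ℕ) : A :=
  ((k.factorial : ℂ)⁻¹) • iteratedDeriv k (fun w : ℂ => B (Function.invFunOn h unitDisk w)) 0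

/-- Solvability of
`k lam m_k - (m_k B₀ - B₀ m_k) = ∑_{l < k} m_l b_{k-l}`, `k ≥ 0`, with `m_0 = 1`. -/
def RecSolvable (lam : ℂ) (B₀ : A) (b : ℕ → A) : Prop :=
  ∃ m : ℕ → A, m 0 = 1 ∧ ∀ k : ℕ,
    ((k : ℂ) * lam) • m k - (m k * B₀ - B₀ * m k) = ∑ l ∈ Finset.range k, m l * b (k - l)

end Algebra

end

/-!
Near the fixed point the Kœnigs function is a coordinate `w = h(z)` in which the flow is
`w ↦ e^{-λt} w`. Differentiating `M(F_t) Γ_t = e^{tC} M` at `t = 0` gives `f M' + M B = C M`;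
evaluating at `z₀` shows that after the normalisation `M(z₀) = 1` one has `C = B₀`, and for
`n = M ∘ h⁻¹` the equation becomes the Fuchsian equation `λ w n' = n b - B₀ n`, whose Taylor
coefficients obey the recursion. Conversely every formal solution converges, because `kλ`
dominates the commutator with `B₀` for large `k`; this gives `M` near `z₀`, and
`M(z) = e^{-tC} M(F_t(z)) Γ_t(z)` with `t` large extends it to the disk.

The Kœnigs function is the solution of `h' f = -λ h`. It is injective because `h(z) = h(w)` forces
the orbits of `z` and `w` to meet near the attracting point `z₀`, and then, `h` being locally
injective, to coincide at all times.
-/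

noncomputable section

/-! ### Taylor coefficients at the origin -/

section TaylorCoeff

variable {E : Type*} [NormedAddCommGroup E] [NormedSpace ℂ E]

/-- The `k`-th Taylor coefficient at `0`, normalised so that `koenigsCoeff B h` is by definition
the sequence of Taylor coefficients of `B ∘ h⁻¹`. -/
def taylorCoeff (u : ℂ → E) (k : ℕ) : E := ((k.factorial : ℂ)⁻¹) • iteratedDeriv k u 0

theorem taylorCoeff_zero (u : ℂ → E) : taylorCoeff u 0 = u 0 := by
  simp [taylorCoeff]

theorem taylorCoeff_congr {u v : ℂ → E} (h : u =ᶠ[𝓝 0] v) (k : ℕ) :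
    taylorCoeff u k = taylorCoeff v k := by
  rw [taylorCoeff, taylorCoeff, h.iteratedDeriv_eq]

theorem taylorCoeff_sub {u v : ℂ → E} {k : ℕ} (hu : ContDiffAt ℂ k u 0)
    (hv : ContDiffAt ℂ k v 0) :
    taylorCoeff (fun w => u w - v w) k = taylorCoeff u k - taylorCoeff v k := by
  rw [taylorCoeff, iteratedDeriv_fun_sub hu hv, smul_sub, taylorCoeff, taylorCoeff]

theorem taylorCoeff_const_smul {u : ℂ → E} {k : ℕ} (c : ℂ) (hu : ContDiffAt ℂ k u 0) :
    taylorCoeff (fun w => c • u w) k = c • taylorCoeff u k := by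
  rw [taylorCoeff, iteratedDeriv_fun_const_smul hu c, smul_comm, taylorCoeff]

theorem taylorCoeff_id_smul_deriv {u : ℂ → E} {k : ℕ} (hu : ContDiffAt ℂ k (deriv u) 0) :
    taylorCoeff (fun w => w • deriv u w) k = (k : ℂ) • taylorCoeff u k := by
  have leibniz := iteratedDerivWithin_smul (mem_univ (0 : ℂ)) uniqueDiffOn_univ
    contDiffWithinAt_id hu.contDiffWithinAt
  simp only [iteratedDerivWithin_univ, iteratedDeriv_id] at leibniz
  rw [taylorCoeff, taylorCoeff, smul_comm]
  congr 1
  refine leibniz.trans ?_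
  rcases k with _ | k
  · simp
  · rw [Finset.sum_eq_single 1 (fun i _ hi => by simp [hi]) (by simp)]
    simp [iteratedDeriv_succ', ← Nat.cast_smul_eq_nsmul ℂ]

theorem taylorCoeff_eq_coeff [CompleteSpace E] {u : ℂ → E} {p : FormalMultilinearSeries ℂ ℂ E}
    (h : HasFPowerSeriesAt u p 0) (k : ℕ) : taylorCoeff u k = p.coeff k := by
  obtain ⟨r, hr⟩ := h
  have hk : (k.factorial : ℂ) ≠ 0 := Nat.cast_ne_zero.mpr k.factorial_ne_zero
  rw [taylorCoeff, iteratedDeriv_eq_iteratedFDeriv, ← hr.factorial_smul (1 : ℂ) k,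
    ← Nat.cast_smul_eq_nsmul ℂ, inv_smul_smul₀ hk]
  rfl

theorem exists_norm_taylorCoeff_le [CompleteSpace E] {u : ℂ → E} (hu : AnalyticAt ℂ u 0) :
    ∃ K R : ℝ, 0 < K ∧ 0 < R ∧ ∀ k, ‖taylorCoeff u k‖ ≤ K * R ^ k := by
  obtain ⟨p, hp⟩ := hu
  obtain ⟨K, R, hK, hR, hbound⟩ := p.le_mul_pow_of_radius_pos hp.radius_pos
  refine ⟨K, R, hK, hR, fun k => ?_⟩
  rw [taylorCoeff_eq_coeff hp, ← p.norm_apply_eq_norm_coef]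
  exact hbound k

theorem exists_analyticAt_taylorCoeff_eq [CompleteSpace E] {m : ℕ → E} {C R : ℝ} (hR : 0 < R)
    (hm : ∀ k, ‖m k‖ ≤ C * R ^ k) :
    ∃ u : ℂ → E, AnalyticAt ℂ u 0 ∧ taylorCoeff u = m := by
  let p : FormalMultilinearSeries ℂ ℂ E := fun k =>
    ContinuousMultilinearMap.mkPiRing ℂ (Fin k) (m k)
  have le_radius : ((Real.toNNReal R⁻¹ : NNReal) : ENNReal) ≤ p.radius := by
    refine p.le_radius_of_bound C fun k => ?_
    rw [ContinuousMultilinearMap.norm_mkPiRing, Real.coe_toNNReal _ (by positivity), inv_pow,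
      ← div_eq_mul_inv, div_le_iff₀ (by positivity)]
    exact hm k
  have radius_pos : 0 < p.radius := lt_of_lt_of_le (by simpa using hR) le_radius
  have hp := (p.hasFPowerSeriesOnBall radius_pos).hasFPowerSeriesAt
  refine ⟨p.sum, hp.analyticAt, funext fun k => ?_⟩
  rw [taylorCoeff_eq_coeff hp]
  simp [p, FormalMultilinearSeries.coeff]

theorem eventuallyEq_zero_of_taylorCoeff [CompleteSpace E] {u : ℂ → E} (hu : AnalyticAt ℂ u 0)
    (h : ∀ k, taylorCoeff u k = 0) : ∀ᶠ w in 𝓝 0, u w = 0 := by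
  obtain ⟨p, hp⟩ := hu
  have p_eq_zero : p = 0 := by
    ext1 k
    exact FormalMultilinearSeries.coeff_eq_zero.mp ((taylorCoeff_eq_coeff hp k).symm.trans (h k))
  exact HasFPowerSeriesAt.eventually_eq_zero (p_eq_zero ▸ hp)

variable {A : Type*} [NormedRing A] [NormedAlgebra ℂ A]

theorem taylorCoeff_const_mul {u : ℂ → A} {k : ℕ} (c : A) (hu : ContDiffAt ℂ k u 0) :
    taylorCoeff (fun w => c * u w) k = c * taylorCoeff u k := by
  rw [taylorCoeff, iteratedDeriv_const_mul c hu, ← mul_smul_comm, taylorCoeff]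

theorem taylorCoeff_mul {u v : ℂ → A} {k : ℕ} (hu : ContDiffAt ℂ k u 0)
    (hv : ContDiffAt ℂ k v 0) :
    taylorCoeff (fun w => u w * v w) k =
      ∑ l ∈ Finset.range (k + 1), taylorCoeff u l * taylorCoeff v (k - l) := by
  simp only [taylorCoeff]
  rw [iteratedDeriv_fun_mul hu hv, Finset.smul_sum]
  refine Finset.sum_congr rfl fun l hl => ?_
  rw [smul_mul_smul_comm, mul_assoc, ← nsmul_eq_mul, ← Nat.cast_smul_eq_nsmul ℂ, smul_smul,
    Nat.cast_choose ℂ (Finset.mem_range_succ_iff.mp hl)]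
  congr 1
  have factorial_ne_zero (j : ℕ) : (j.factorial : ℂ) ≠ 0 :=
    Nat.cast_ne_zero.mpr j.factorial_ne_zero
  field_simp [factorial_ne_zero]

end TaylorCoeff

/-! ### The Fuchsian equation -/

theorem exists_le_mul_two_mul_pow {a : ℕ → ℝ} {R : ℝ} (hR : 0 < R) {k₀ : ℕ}
    (ha : ∀ k ≥ k₀, a k ≤ ∑ l ∈ Finset.range k, a l * R ^ (k - l)) :
    ∃ C, ∀ k, a k ≤ C * (2 * R) ^ k := by
  let C : ℝ := ∑ j ∈ Finset.range k₀, |a j| / (2 * R) ^ j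
  have : 0 ≤ C := Finset.sum_nonneg fun j _ => by positivity
  refine ⟨C, fun k => ?_⟩
  induction k using Nat.strong_induction_on with
  | _ k ih =>
    rcases lt_or_ge k k₀ with hk | hk
    · rw [← div_le_iff₀ (by positivity)]
      calc a k / (2 * R) ^ k ≤ |a k| / (2 * R) ^ k := by gcongr; exact le_abs_self _
        _ ≤ C := Finset.single_le_sum (f := fun j => |a j| / (2 * R) ^ j)
          (fun j _ => by positivity) (Finset.mem_range.mpr hk)
    · calc a k ≤ ∑ l ∈ Finset.range k, a l * R ^ (k - l) := ha k hk
        _ ≤ ∑ l ∈ Finset.range k, C * (2 * R) ^ l * R ^ (k - l) := by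
          gcongr with l hl
          exact ih l (Finset.mem_range.mp hl)
        _ = ∑ l ∈ Finset.range k, C * R ^ k * 2 ^ l := by
          refine Finset.sum_congr rfl fun l hl => ?_
          rw [← pow_mul_pow_sub R (Finset.mem_range.mp hl).le, mul_pow]
          ring
        _ = C * R ^ k * (2 ^ k - 1) := by
          rw [← Finset.mul_sum, geom_sum_eq (by norm_num)]
          norm_num
        _ ≤ C * R ^ k * 2 ^ k := by gcongr; linarith
        _ = C * (2 * R) ^ k := by rw [mul_pow]; ring

section Fuchsian

variable {A : Type*} [NormedRing A] [NormedAlgebra ℂ A]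

/-- The residual `lam w n'(w) - (n(w) b(w) - b(0) n(w))` of the Fuchsian equation at the origin
whose power series solutions are the solutions of the recursion in `RecSolvable`. -/
def fuchsResidual (lam : ℂ) (b n : ℂ → A) (w : ℂ) : A :=
  lam • w • deriv n w - (n w * b w - b 0 * n w)

theorem taylorCoeff_fuchsResidual [CompleteSpace A] {b n : ℂ → A} (hb : AnalyticAt ℂ b 0)
    (hn : AnalyticAt ℂ n 0) (lam : ℂ) (k : ℕ) :
    taylorCoeff (fuchsResidual lam b n) k =
      ((k : ℂ) * lam) • taylorCoeff n k - (taylorCoeff n k * b 0 - b 0 * taylorCoeff n k)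
        - ∑ l ∈ Finset.range k, taylorCoeff n l * taylorCoeff b (k - l) := by
  have hb' : ContDiffAt ℂ k b 0 := hb.contDiffAt
  have hn' : ContDiffAt ℂ k n 0 := hn.contDiffAt
  have hd' : ContDiffAt ℂ k (deriv n) 0 := hn.deriv.contDiffAt
  have hwd : ContDiffAt ℂ k (fun w => w • deriv n w) 0 := contDiffAt_id.smul hd'
  unfold fuchsResidual
  rw [taylorCoeff_sub (hwd.const_smul lam) ((hn'.mul hb').sub (contDiffAt_const.mul hn')),
    taylorCoeff_sub (hn'.mul hb') (contDiffAt_const.mul hn'), taylorCoeff_const_smul lam hwd,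
    taylorCoeff_id_smul_deriv hd', taylorCoeff_mul hn' hb', taylorCoeff_const_mul _ hn',
    Finset.sum_range_succ, Nat.sub_self, taylorCoeff_zero b, smul_smul, mul_comm lam]
  abel

theorem exists_norm_le_of_recursion {lam : ℂ} (hlam : lam ≠ 0) {B₀ : A} {b m : ℕ → A}
    {K R : ℝ} (hK : 0 < K) (hR : 0 < R) (hb : ∀ k, ‖b k‖ ≤ K * R ^ k)
    (hm : ∀ k : ℕ, ((k : ℂ) * lam) • m k - (m k * B₀ - B₀ * m k)
      = ∑ l ∈ Finset.range k, m l * b (k - l)) :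
    ∃ C, ∀ k, ‖m k‖ ≤ C * (2 * R) ^ k := by
  obtain ⟨k₀, hk₀⟩ := exists_nat_gt ((K + 2 * ‖B₀‖) / ‖lam‖)
  rw [div_lt_iff₀ (norm_pos_iff.mpr hlam)] at hk₀
  refine exists_le_mul_two_mul_pow hR (k₀ := k₀) fun k hk => ?_
  have lower : K ≤ k * ‖lam‖ - 2 * ‖B₀‖ := by
    have : (k₀ : ℝ) * ‖lam‖ ≤ k * ‖lam‖ := by gcongr
    linarith
  have commutator : ‖m k * B₀ - B₀ * m k‖ ≤ 2 * ‖B₀‖ * ‖m k‖ := by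
    linarith [norm_sub_le (m k * B₀) (B₀ * m k), norm_mul_le (m k) B₀, norm_mul_le B₀ (m k)]
  refine le_of_mul_le_mul_left ?_ hK
  calc K * ‖m k‖ ≤ (k * ‖lam‖ - 2 * ‖B₀‖) * ‖m k‖ := by gcongr
    _ ≤ ‖((k : ℂ) * lam) • m k‖ - ‖m k * B₀ - B₀ * m k‖ := by
      rw [norm_smul, norm_mul, Complex.norm_natCast]
      linarith
    _ ≤ ‖∑ l ∈ Finset.range k, m l * b (k - l)‖ := hm k ▸ norm_sub_norm_le _ _
    _ ≤ ∑ l ∈ Finset.range k, ‖m l‖ * (K * R ^ (k - l)) :=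
      norm_sum_le_of_le _ fun l _ => (norm_mul_le _ _).trans (by gcongr; exact hb _)
    _ = K * ∑ l ∈ Finset.range k, ‖m l‖ * R ^ (k - l) := by
      rw [Finset.mul_sum]
      exact Finset.sum_congr rfl fun l _ => mul_left_comm _ _ _

theorem recSolvable_iff_exists_analyticAt [CompleteSpace A] {lam : ℂ} (hlam : lam ≠ 0)
    {b : ℂ → A} (hb : AnalyticAt ℂ b 0) :
    RecSolvable lam (b 0) (taylorCoeff b) ↔
      ∃ n : ℂ → A, AnalyticAt ℂ n 0 ∧ n 0 = 1 ∧ ∀ᶠ w in 𝓝 0, fuchsResidual lam b n w = 0 := by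
  constructor
  · rintro ⟨m, hm0, hm⟩
    obtain ⟨K, R, hK, hR, hbound⟩ := exists_norm_taylorCoeff_le hb
    obtain ⟨C, hC⟩ := exists_norm_le_of_recursion hlam hK hR hbound hm
    obtain ⟨n, hn, rfl⟩ := exists_analyticAt_taylorCoeff_eq (by positivity : 0 < 2 * R) hC
    refine ⟨n, hn, taylorCoeff_zero n ▸ hm0, eventuallyEq_zero_of_taylorCoeff ?_ fun k => ?_⟩
    · exact ((analyticAt_id.smul hn.deriv).const_smul (c := lam)).sub
        ((hn.mul hb).sub (analyticAt_const.mul hn))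
    · rw [taylorCoeff_fuchsResidual hb hn, hm k, sub_self]
  · rintro ⟨n, hn, hn0, hres⟩
    refine ⟨taylorCoeff n, by rw [taylorCoeff_zero, hn0], fun k => ?_⟩
    rw [← sub_eq_zero, ← taylorCoeff_fuchsResidual hb hn, taylorCoeff_congr (v := 0) hres]
    simp [taylorCoeff]

end Fuchsian

/-! ### Self-maps of the disk with a fixed point -/

section Moebius

/-- The disk automorphism `z ↦ (z - a) / (1 - \bar a z)` moving `a` to the origin; its inverse is
`diskMoebius (-a)`. -/
def diskMoebius (a z : ℂ) : ℂ := (z - a) / (1 - (starRingEnd ℂ) a * z)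

/-- The conjugate of `G` by `diskMoebius a`; it fixes the origin when `G` fixes `a`. -/
def diskConj (a : ℂ) (G : ℂ → ℂ) (w : ℂ) : ℂ := diskMoebius a (G (diskMoebius (-a) w))

theorem mem_unitDisk {z : ℂ} : z ∈ unitDisk ↔ ‖z‖ < 1 := mem_ball_zero_iff

theorem neg_mem_unitDisk {a : ℂ} (ha : a ∈ unitDisk) : -a ∈ unitDisk := by
  rwa [mem_unitDisk, norm_neg, ← mem_unitDisk]

theorem diskMoebius_self (a : ℂ) : diskMoebius a a = 0 := by simp [diskMoebius]

theorem diskMoebius_zero (a : ℂ) : diskMoebius a 0 = -a := by simp [diskMoebius]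

variable {a : ℂ} {G : ℂ → ℂ}

theorem one_sub_conj_mul_ne_zero {z : ℂ} (ha : a ∈ unitDisk) (hz : z ∈ unitDisk) :
    1 - (starRingEnd ℂ) a * z ≠ 0 := by
  intro h
  have norm_eq : ‖a‖ * ‖z‖ = 1 := by
    rw [← RCLike.norm_conj a, ← norm_mul, ← sub_eq_zero.mp h, norm_one]
  nlinarith [mem_unitDisk.mp ha, mem_unitDisk.mp hz, norm_nonneg a, norm_nonneg z]

theorem differentiableOn_diskMoebius (ha : a ∈ unitDisk) :
    DifferentiableOn ℂ (diskMoebius a) unitDisk := by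
  unfold diskMoebius
  exact DifferentiableOn.div (by fun_prop) (by fun_prop)
    fun z hz => one_sub_conj_mul_ne_zero ha hz

theorem normSq_one_sub_conj_mul (a z : ℂ) :
    Complex.normSq (1 - (starRingEnd ℂ) a * z) - Complex.normSq (z - a)
      = (1 - Complex.normSq a) * (1 - Complex.normSq z) := by
  simp only [Complex.normSq_apply, Complex.sub_re, Complex.sub_im, Complex.mul_re,
    Complex.mul_im, Complex.conj_re, Complex.conj_im, Complex.one_re, Complex.one_im]
  ring

theorem mapsTo_diskMoebius (ha : a ∈ unitDisk) : MapsTo (diskMoebius a) unitDisk unitDisk := by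
  intro z hz
  have normSq_lt_one {w : ℂ} (hw : w ∈ unitDisk) : Complex.normSq w < 1 := by
    rw [Complex.normSq_eq_norm_sq]
    exact pow_lt_one₀ (norm_nonneg w) (mem_unitDisk.mp hw) two_ne_zero
  rw [mem_unitDisk, diskMoebius, norm_div,
    div_lt_one (norm_pos_iff.mpr (one_sub_conj_mul_ne_zero ha hz))]
  refine lt_of_pow_lt_pow_left₀ 2 (norm_nonneg _) ?_
  rw [← Complex.normSq_eq_norm_sq, ← Complex.normSq_eq_norm_sq, ← sub_pos,
    normSq_one_sub_conj_mul]
  exact mul_pos (sub_pos.mpr (normSq_lt_one ha)) (sub_pos.mpr (normSq_lt_one hz))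

theorem leftInvOn_diskMoebius (ha : a ∈ unitDisk) :
    LeftInvOn (diskMoebius (-a)) (diskMoebius a) unitDisk := by
  intro z hz
  have hdiv : diskMoebius a z * (1 - (starRingEnd ℂ) a * z) = z - a :=
    div_mul_cancel₀ _ (one_sub_conj_mul_ne_zero ha hz)
  rw [diskMoebius,
    div_eq_iff (one_sub_conj_mul_ne_zero (neg_mem_unitDisk ha) (mapsTo_diskMoebius ha hz)), map_neg]
  linear_combination hdiv

theorem diskConj_zero (hfix : G a = a) : diskConj a G 0 = 0 := by
  rw [diskConj, diskMoebius_zero, neg_neg, hfix, diskMoebius_self]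

theorem diskConj_diskMoebius {z : ℂ} (ha : a ∈ unitDisk) (hz : z ∈ unitDisk) :
    diskConj a G (diskMoebius a z) = diskMoebius a (G z) := by
  rw [diskConj, leftInvOn_diskMoebius ha hz]

theorem mapsTo_diskConj (ha : a ∈ unitDisk) (hm : MapsTo G unitDisk unitDisk) :
    MapsTo (diskConj a G) unitDisk unitDisk :=
  (mapsTo_diskMoebius ha).comp (hm.comp (mapsTo_diskMoebius (neg_mem_unitDisk ha)))

theorem differentiableOn_diskConj (ha : a ∈ unitDisk) (hd : DifferentiableOn ℂ G unitDisk)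
    (hm : MapsTo G unitDisk unitDisk) : DifferentiableOn ℂ (diskConj a G) unitDisk :=
  have ha' := neg_mem_unitDisk ha
  (differentiableOn_diskMoebius ha).comp
    (hd.comp (differentiableOn_diskMoebius ha') (mapsTo_diskMoebius ha'))
    (hm.comp (mapsTo_diskMoebius ha'))

theorem norm_diskMoebius_apply_le {z : ℂ} (ha : a ∈ unitDisk) (hz : z ∈ unitDisk)
    (hd : DifferentiableOn ℂ G unitDisk) (hm : MapsTo G unitDisk unitDisk) (hfix : G a = a) :
    ‖diskMoebius a (G z)‖ ≤ ‖diskMoebius a z‖ := by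
  rw [← diskConj_diskMoebius ha hz]
  exact Complex.norm_le_norm_of_mapsTo_ball (differentiableOn_diskConj ha hd hm)
    ((mapsTo_diskConj ha hm).mono_right Metric.ball_subset_closedBall) (diskConj_zero hfix)
    (mem_unitDisk.mp (mapsTo_diskMoebius ha hz))

theorem eqOn_id_of_fixed_zero {b : ℂ} (hb : b ∈ unitDisk) (hb0 : b ≠ 0)
    (hd : DifferentiableOn ℂ G unitDisk) (hm : MapsTo G unitDisk unitDisk)
    (hfix : G 0 = 0) (hfixb : G b = b) : EqOn G id unitDisk := by
  have slope_eq_one : dslope G 0 b = 1 := by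
    rw [dslope_of_ne _ hb0, slope_def_field, hfixb, hfix, sub_zero, div_self hb0]
  have hm' : MapsTo G (Metric.ball 0 1) (Metric.closedBall (G 0) 1) :=
    hfix.symm ▸ hm.mono_right Metric.ball_subset_closedBall
  have affine := Complex.affine_of_mapsTo_ball_of_norm_dslope_eq_div hd hm' hb
    (by rw [slope_eq_one]; simp)
  intro z hz
  simpa [slope_eq_one, hfix] using affine hz

theorem eqOn_id_of_two_fixed {b : ℂ} (ha : a ∈ unitDisk) (hb : b ∈ unitDisk) (hab : b ≠ a)
    (hd : DifferentiableOn ℂ G unitDisk) (hm : MapsTo G unitDisk unitDisk)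
    (hfa : G a = a) (hfb : G b = b) : EqOn G id unitDisk := by
  have inj := (leftInvOn_diskMoebius ha).injOn
  have hb0 : diskMoebius a b ≠ 0 := fun h =>
    hab (inj hb ha (h.trans (diskMoebius_self a).symm))
  have conj_eq_id := eqOn_id_of_fixed_zero (mapsTo_diskMoebius ha hb) hb0
    (differentiableOn_diskConj ha hd hm) (mapsTo_diskConj ha hm) (diskConj_zero hfa)
    (by rw [diskConj_diskMoebius ha hb, hfb])
  intro z hz
  refine inj (hm hz) hz ?_
  rw [← diskConj_diskMoebius ha hz]
  exact conj_eq_id (mapsTo_diskMoebius ha hz)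

end Moebius

/-! ### The flow and its Kœnigs function -/

section Flow

variable {F : ℝ → ℂ → ℂ} {f h : ℂ → ℂ} {z₀ z lam : ℂ}

theorem IsHolSemigroup.continuousOn_orbit (hF : IsHolSemigroup F) (hz : z ∈ unitDisk) :
    ContinuousOn (fun t => F t z) (Ici 0) :=
  hF.continuous.comp (f := fun t : ℝ => (t, z)) (by fun_prop) fun _ ht => ⟨ht, hz⟩

theorem IsSemigroupGenerator.hasDerivWithinAt_zero (hF : IsHolSemigroup F)
    (hf : IsSemigroupGenerator F f) (hz : z ∈ unitDisk) :
    HasDerivWithinAt (fun t => F t z) (f z) (Ici 0) 0 := by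
  rw [← hasDerivWithinAt_Ioi_iff_Ici, hasDerivWithinAt_iff_tendsto_slope' (by simp)]
  refine (hf.tendsto z hz).congr fun t => ?_
  rw [slope_def_module, hF.zero z hz, sub_zero, ← Complex.coe_smul, smul_eq_mul,
    Complex.ofReal_inv, div_eq_inv_mul]

theorem IsSemigroupGenerator.hasDerivWithinAt_orbit (hF : IsHolSemigroup F)
    (hf : IsSemigroupGenerator F f) (hz : z ∈ unitDisk) {t : ℝ} (ht : 0 ≤ t) :
    HasDerivWithinAt (fun s => F s z) (f (F t z)) (Ici t) t := by
  have shift : HasDerivWithinAt (fun s : ℝ => s - t) 1 (Ici t) t :=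
    ((hasDerivAt_id t).sub_const t).hasDerivWithinAt
  have deriv_shifted := (hf.hasDerivWithinAt_zero hF (hF.mapsTo t ht hz)).scomp_of_eq t shift
    (fun s hs => mem_Ici.mpr (sub_nonneg.mpr hs)) (sub_self t).symm
  have orbit_eq {s : ℝ} (hs : t ≤ s) : F s z = F (s - t) (F t z) := by
    rw [← hF.add _ _ (sub_nonneg.mpr hs) ht z hz, sub_add_cancel]
  rw [one_smul] at deriv_shifted
  exact deriv_shifted.congr (fun s hs => orbit_eq hs) (orbit_eq le_rfl)

theorem sub_mul_dslope_of_eq_zero (hf0 : f z₀ = 0) (w : ℂ) : (w - z₀) * dslope f z₀ w = f w := by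
  simpa [hf0] using sub_smul_dslope f z₀ w

theorem IsSemigroupGenerator.fixed_of_zero (hF : IsHolSemigroup F)
    (hf : IsSemigroupGenerator F f) (hz₀ : z₀ ∈ unitDisk) (hf0 : f z₀ = 0)
    {t : ℝ} (ht : 0 ≤ t) : F t z₀ = z₀ := by
  have orbit_cont : ContinuousOn (fun s => F s z₀) (Icc 0 t) :=
    (hF.continuousOn_orbit hz₀).mono Icc_subset_Ici_self
  have slope_cont : ContinuousOn (dslope f z₀) unitDisk :=
    ((Complex.differentiableOn_dslope (Metric.isOpen_ball.mem_nhds hz₀)).mpr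
      hf.holomorphic).continuousOn
  obtain ⟨K, hK⟩ := isCompact_Icc.exists_bound_of_continuousOn
    (slope_cont.comp orbit_cont fun s hs => hF.mapsTo s hs.1 hz₀)
  have deriv_le (s : ℝ) (hs : s ∈ Ico 0 t) : ‖f (F s z₀)‖ ≤ K * ‖F s z₀ - z₀‖ := by
    rw [← sub_mul_dslope_of_eq_zero hf0, norm_mul, mul_comm]
    gcongr
    exact hK s (Ico_subset_Icc_self hs)
  exact sub_eq_zero.mp <| eq_zero_of_abs_deriv_le_mul_abs_self_of_eq_zero_right
    (f := fun s => F s z₀ - z₀) (orbit_cont.sub continuousOn_const)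
    (fun s hs => (hf.hasDerivWithinAt_orbit hF hz₀ hs.1).sub_const z₀)
    (by simp [hF.zero z₀ hz₀]) deriv_le t (right_mem_Icc.mpr ht)

theorem IsSemigroupGenerator.eq_of_zero (hF : IsHolSemigroup F)
    (hf : IsSemigroupGenerator F f) (hz₀ : z₀ ∈ unitDisk) (hf0 : f z₀ = 0)
    (hd : deriv f z₀ ≠ 0) (hz : z ∈ unitDisk) (hfz : f z = 0) : z = z₀ := by
  by_contra hne
  have flow_eq_id (t : ℝ) (ht : 0 ≤ t) : EqOn (F t) id unitDisk :=
    eqOn_id_of_two_fixed hz₀ hz hne (hF.holomorphic t ht) (hF.mapsTo t ht)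
      (hf.fixed_of_zero hF hz₀ hf0 ht) (hf.fixed_of_zero hF hz hfz ht)
  have generator_eq_zero (w : ℂ) (hw : w ∈ unitDisk) : f w = 0 := by
    refine tendsto_nhds_unique (hf.tendsto w hw) (tendsto_const_nhds.congr' ?_)
    filter_upwards [self_mem_nhdsWithin] with t ht
    rw [flow_eq_id t (le_of_lt ht) hw, id, sub_self, zero_div]
  have f_eventuallyEq : f =ᶠ[𝓝 z₀] fun _ => 0 := by
    filter_upwards [Metric.isOpen_ball.mem_nhds hz₀] with w hw using generator_eq_zero w hw
  exact hd (by rw [f_eventuallyEq.deriv_eq, deriv_const])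

theorem IsHolSemigroup.exists_isCompact_orbit_subset (hF : IsHolSemigroup F)
    (hz₀ : z₀ ∈ unitDisk) (hz : z ∈ unitDisk) (hfix : ∀ t, 0 ≤ t → F t z₀ = z₀) :
    ∃ K : Set ℂ, IsCompact K ∧ K ⊆ unitDisk ∧ ∀ t, 0 ≤ t → F t z ∈ K := by
  have ball_subset : Metric.closedBall (0 : ℂ) ‖diskMoebius z₀ z‖ ⊆ unitDisk :=
    Metric.closedBall_subset_ball (mem_unitDisk.mp (mapsTo_diskMoebius hz₀ hz))
  have hz₀' := neg_mem_unitDisk hz₀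
  refine ⟨diskMoebius (-z₀) '' Metric.closedBall 0 ‖diskMoebius z₀ z‖,
    (isCompact_closedBall _ _).image_of_continuousOn
      ((differentiableOn_diskMoebius hz₀').continuousOn.mono ball_subset),
    ((mapsTo_diskMoebius hz₀').mono_left ball_subset).image_subset, fun t ht =>
      ⟨diskMoebius z₀ (F t z), ?_, leftInvOn_diskMoebius hz₀ (hF.mapsTo t ht hz)⟩⟩
  rw [mem_closedBall_zero_iff]
  exact norm_diskMoebius_apply_le hz₀ hz (hF.holomorphic t ht) (hF.mapsTo t ht) (hfix t ht)

theorem tendsto_exp_neg_mul (hre : 0 < lam.re) :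
    Tendsto (fun t : ℝ => Complex.exp (-lam * t)) atTop (𝓝 0) := by
  rw [tendsto_zero_iff_norm_tendsto_zero]
  simp only [Complex.norm_exp, Complex.re_mul_ofReal, Complex.neg_re, neg_mul]
  exact Real.tendsto_exp_neg_atTop_nhds_zero.comp (tendsto_id.const_mul_atTop hre)

theorem tendsto_zero_of_eq_exp_neg_mul {u : ℝ → ℂ} {a : ℂ} (hre : 0 < lam.re)
    (hu : ∀ t : ℝ, 0 ≤ t → u t = Complex.exp (-lam * t) * a) : Tendsto u atTop (𝓝 0) := by
  have decay := (tendsto_exp_neg_mul hre).mul_const a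
  rw [zero_mul] at decay
  refine decay.congr' ?_
  filter_upwards [eventually_ge_atTop 0] with t ht using (hu t ht).symm

theorem hasDerivAt_exp_mul_ofReal (c : ℂ) (t : ℝ) :
    HasDerivAt (fun s : ℝ => Complex.exp (c * s)) (Complex.exp (c * t) * c) t := by
  simpa using ((Complex.ofRealCLM.hasDerivAt (x := t)).const_mul c).cexp

theorem IsSemigroupGenerator.schroeder_of_deriv_mul (hF : IsHolSemigroup F)
    (hf : IsSemigroupGenerator F f) (hd : DifferentiableOn ℂ h unitDisk)
    (heq : ∀ z ∈ unitDisk, deriv h z * f z = -lam * h z) {t : ℝ} (ht : 0 ≤ t)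
    (hz : z ∈ unitDisk) : h (F t z) = Complex.exp (-lam * t) * h z := by
  have exp_mul_const := constant_of_has_deriv_right_zero (a := 0) (b := t)
    (f := fun s : ℝ => Complex.exp (lam * s) * h (F s z))
    (ContinuousOn.mul (by fun_prop)
      (hd.continuousOn.comp ((hF.continuousOn_orbit hz).mono Icc_subset_Ici_self)
        fun s hs => hF.mapsTo s hs.1 hz))
    (fun s hs => by
      have hw := hF.mapsTo s hs.1 hz
      have deriv_comp := (hd.hasDerivAt (Metric.isOpen_ball.mem_nhds hw)).comp_hasDerivWithinAt s
        (hf.hasDerivWithinAt_orbit hF hz hs.1)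
      refine ((hasDerivAt_exp_mul_ofReal lam s).hasDerivWithinAt.mul deriv_comp).congr_deriv ?_
      rw [Function.comp_apply, heq _ hw]
      ring)
    t (right_mem_Icc.mpr ht)
  simp only [Complex.ofReal_zero, mul_zero, Complex.exp_zero, one_mul, hF.zero z hz]
    at exp_mul_const
  rw [← exp_mul_const, ← mul_assoc, ← Complex.exp_add]
  simp

theorem exists_hasDerivAt_sub_mul_exp {k : ℂ → ℂ} {c : ℂ} {r : ℝ}
    (hz₀ : z₀ ∈ Metric.ball c r) (hk : DifferentiableOn ℂ k (Metric.ball c r)) (hk0 : k z₀ = 1) :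
    ∃ p : ℂ → ℂ, p z₀ = 0 ∧ ∀ z ∈ Metric.ball c r,
      HasDerivAt (fun z => (z - z₀) * Complex.exp (p z)) (Complex.exp (p z) * k z) z := by
  have slope_diff : DifferentiableOn ℂ (dslope k z₀) (Metric.ball c r) :=
    (Complex.differentiableOn_dslope (Metric.isOpen_ball.mem_nhds hz₀)).mpr hk
  obtain ⟨p, hp0, hp⟩ := slope_diff.isExactOn_ball.with_val_at z₀ 0
  refine ⟨p, hp0, fun z hz => ?_⟩
  refine (((hasDerivAt_id z).sub_const z₀).mul (hp z hz).cexp).congr_deriv ?_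
  have slope_eq : (z - z₀) * dslope k z₀ z = k z - 1 := hk0 ▸ sub_smul_dslope k z₀ z
  simp only [id_eq]
  linear_combination Complex.exp (p z) * slope_eq

/-- The solution is `h(z) = (z - z₀) exp p(z)` with `p' = (f'(z₀) / g - 1) / (z - z₀)`, where
`f = (z - z₀) g`. -/
theorem exists_eigenfunction {c : ℂ} {r : ℝ} (hz₀ : z₀ ∈ Metric.ball c r)
    (hf : DifferentiableOn ℂ f (Metric.ball c r)) (hf0 : f z₀ = 0) (hd0 : deriv f z₀ ≠ 0)
    (hzero : ∀ z ∈ Metric.ball c r, f z = 0 → z = z₀) :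
    ∃ h : ℂ → ℂ, DifferentiableOn ℂ h (Metric.ball c r) ∧
      (∀ z ∈ Metric.ball c r, deriv h z * f z = deriv f z₀ * h z) ∧
      (∀ z ∈ Metric.ball c r, deriv h z ≠ 0) ∧ h z₀ = 0 ∧ deriv h z₀ = 1 := by
  have slope_diff : DifferentiableOn ℂ (dslope f z₀) (Metric.ball c r) :=
    (Complex.differentiableOn_dslope (Metric.isOpen_ball.mem_nhds hz₀)).mpr hf
  have slope_ne_zero (z : ℂ) (hz : z ∈ Metric.ball c r) : dslope f z₀ z ≠ 0 := fun h => by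
    have z_eq := hzero z hz (by rw [← sub_mul_dslope_of_eq_zero hf0, h, mul_zero])
    exact hd0 (by rw [← dslope_same, ← h, z_eq])
  let k : ℂ → ℂ := fun z => deriv f z₀ / dslope f z₀ z
  have hk0 : k z₀ = 1 := by simp only [k, dslope_same, div_self hd0]
  have hk : DifferentiableOn ℂ k (Metric.ball c r) :=
    (differentiableOn_const _).div slope_diff slope_ne_zero
  obtain ⟨p, hp0, hder⟩ := exists_hasDerivAt_sub_mul_exp hz₀ hk hk0
  refine ⟨fun z => (z - z₀) * Complex.exp (p z),
    fun z hz => (hder z hz).differentiableAt.differentiableWithinAt, fun z hz => ?_,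
    fun z hz => ?_, by simp, ?_⟩
  · have hne := slope_ne_zero z hz
    rw [(hder z hz).deriv, ← sub_mul_dslope_of_eq_zero hf0 z]
    simp only [k]
    field_simp
  · rw [(hder z hz).deriv]
    exact mul_ne_zero (Complex.exp_ne_zero _) (div_ne_zero hd0 (slope_ne_zero z hz))
  · rw [(hder z₀ hz₀).deriv, hk0, hp0, Complex.exp_zero, mul_one]

theorem IsHolSemigroup.tendsto_orbit_of_schroeder (hF : IsHolSemigroup F) (hz₀ : z₀ ∈ unitDisk)
    (hfix : ∀ t, 0 ≤ t → F t z₀ = z₀) (hre : 0 < lam.re) (hcont : ContinuousOn h unitDisk)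
    (hs : ∀ t : ℝ, 0 ≤ t → ∀ z ∈ unitDisk, h (F t z) = Complex.exp (-lam * t) * h z)
    (hzero : ∀ z ∈ unitDisk, h z = 0 → z = z₀) (hz : z ∈ unitDisk) :
    Tendsto (fun t => F t z) atTop (𝓝 z₀) := by
  obtain ⟨K, hK, hKD, hKm⟩ := hF.exists_isCompact_orbit_subset hz₀ hz hfix
  refine hK.tendsto_nhds_of_unique_mapClusterPt ((eventually_ge_atTop 0).mono hKm)
    fun y hy cluster => hzero y (hKD hy) ?_
  obtain ⟨U, hU, orbit_tendsto⟩ := mapClusterPt_iff_ultrafilter.mp cluster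
  exact tendsto_nhds_unique
    ((hcont.continuousAt (Metric.isOpen_ball.mem_nhds (hKD hy))).tendsto.comp orbit_tendsto)
    ((tendsto_zero_of_eq_exp_neg_mul hre fun t ht => hs t ht z hz).mono_left hU)

theorem exists_mem_nhds_injOn {U : Set ℂ} (hU : IsOpen U) (hd : DifferentiableOn ℂ h U)
    (hz : z ∈ U) (hne : deriv h z ≠ 0) : ∃ V ∈ 𝓝 z, InjOn h V :=
  ⟨_, ((hd.analyticAt (hU.mem_nhds hz)).hasStrictDerivAt.hasStrictFDerivAt_equiv
    hne).eventually_left_inverse, LeftInvOn.injOn fun _ hx => hx⟩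

theorem isLocallyInjective_domRestrict {U : Set ℂ} (hU : IsOpen U) (hd : DifferentiableOn ℂ h U)
    (hne : ∀ z ∈ U, deriv h z ≠ 0) : IsLocallyInjective (U.domRestrict h) := by
  refine isLocallyInjective_iff_nhds.mpr fun z => ?_
  obtain ⟨V, hV, inj⟩ := exists_mem_nhds_injOn hU hd z.2 (hne z z.2)
  exact ⟨Subtype.val ⁻¹' V, continuousAt_subtype_val.preimage_mem_nhds hV,
    fun x hx y hy hxy => Subtype.ext (inj hx hy hxy)⟩

/-- If `h z = h w`, the orbits of `z` and `w` are lifts of one curve through the locally injective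
`h`, and they agree at large times, where both are close to `z₀`. -/
theorem IsHolSemigroup.injOn_of_schroeder (hF : IsHolSemigroup F)
    (hz₀ : z₀ ∈ unitDisk) (hd : DifferentiableOn ℂ h unitDisk)
    (hne : ∀ z ∈ unitDisk, deriv h z ≠ 0)
    (hs : ∀ t : ℝ, 0 ≤ t → ∀ z ∈ unitDisk, h (F t z) = Complex.exp (-lam * t) * h z)
    (hlim : ∀ z ∈ unitDisk, Tendsto (fun t => F t z) atTop (𝓝 z₀)) : InjOn h unitDisk := by
  intro z hz w hw hzw
  have comp_eq (t : ℝ) (ht : 0 ≤ t) : h (F t z) = h (F t w) := by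
    rw [hs t ht z hz, hs t ht w hw, hzw]
  obtain ⟨T, hT, meet⟩ : ∃ T, 0 ≤ T ∧ F T z = F T w := by
    obtain ⟨V, hV, inj⟩ := exists_mem_nhds_injOn Metric.isOpen_ball hd hz₀ (hne z₀ hz₀)
    obtain ⟨T, hT, hTz, hTw⟩ := ((eventually_ge_atTop 0).and
      (((hlim z hz).eventually_mem hV).and ((hlim w hw).eventually_mem hV))).exists
    exact ⟨T, hT, inj hTz hTw (comp_eq T hT)⟩
  let orbit (x : unitDisk) (t : Ici (0 : ℝ)) : unitDisk := ⟨F t x, hF.mapsTo t t.2 x.2⟩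
  have orbit_cont (x : unitDisk) : Continuous (orbit x) :=
    (hF.continuousOn_orbit x.2).domRestrict.subtype_mk _
  have : PreconnectedSpace (Ici (0 : ℝ)) := Subtype.preconnectedSpace isPreconnected_Ici
  have orbit_eq := (T2Space.isSeparatedMap (unitDisk.domRestrict h)).eq_of_comp_eq
    (isLocallyInjective_domRestrict Metric.isOpen_ball hd hne) (orbit_cont ⟨z, hz⟩)
    (orbit_cont ⟨w, hw⟩) (funext fun t => comp_eq t t.2) ⟨T, hT⟩ (Subtype.ext meet)
  have start_eq : F 0 z = F 0 w := congrArg Subtype.val (congrFun orbit_eq ⟨0, self_mem_Ici⟩)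
  rwa [hF.zero z hz, hF.zero w hw] at start_eq

theorem IsSemigroupGenerator.exists_isKoenigsFunction (hF : IsHolSemigroup F)
    (hf : IsSemigroupGenerator F f) (hz₀ : z₀ ∈ unitDisk) (hf0 : f z₀ = 0)
    (hlam : lam = -deriv f z₀) (hre : 0 < lam.re) :
    ∃ h : ℂ → ℂ, IsKoenigsFunction F z₀ lam h := by
  have hd0 : deriv f z₀ ≠ 0 := fun h => by simp [hlam, h] at hre
  have zero_eq (z : ℂ) : z ∈ unitDisk → f z = 0 → z = z₀ := hf.eq_of_zero hF hz₀ hf0 hd0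
  obtain ⟨h, hd, heq, hne, hh0, hh1⟩ := exists_eigenfunction hz₀ hf.holomorphic hf0 hd0 zero_eq
  have schroeder (t : ℝ) (ht : 0 ≤ t) (z : ℂ) (hz : z ∈ unitDisk) :
      h (F t z) = Complex.exp (-lam * t) * h z :=
    hf.schroeder_of_deriv_mul hF hd (by simpa only [hlam, neg_neg] using heq) ht hz
  have zero_eq' (z : ℂ) (hz : z ∈ unitDisk) (hhz : h z = 0) : z = z₀ :=
    zero_eq z hz ((mul_eq_zero.mp ((heq z hz).trans (by rw [hhz, mul_zero]))).resolve_left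
      (hne z hz))
  have hlim (z : ℂ) : z ∈ unitDisk → Tendsto (fun t => F t z) atTop (𝓝 z₀) :=
    hF.tendsto_orbit_of_schroeder hz₀ (fun t ht => hf.fixed_of_zero hF hz₀ hf0 ht) hre
      hd.continuousOn schroeder zero_eq'
  exact ⟨h, hd, hF.injOn_of_schroeder hz₀ hd hne schroeder hlim, schroeder, hh0, hh1⟩

end Flow

section KoenigsFunction

variable {F : ℝ → ℂ → ℂ} {f h : ℂ → ℂ} {z₀ z lam : ℂ}

theorem IsKoenigsFunction.hasDerivAt (hh : IsKoenigsFunction F z₀ lam h) (hz : z ∈ unitDisk) :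
    HasDerivAt h (deriv h z) z :=
  hh.holomorphic.hasDerivAt (Metric.isOpen_ball.mem_nhds hz)

theorem IsKoenigsFunction.hasStrictDerivAt (hh : IsKoenigsFunction F z₀ lam h)
    (hz : z ∈ unitDisk) : HasStrictDerivAt h (deriv h z) z :=
  (hh.holomorphic.analyticAt (Metric.isOpen_ball.mem_nhds hz)).hasStrictDerivAt

theorem IsKoenigsFunction.deriv_mul_generator (hh : IsKoenigsFunction F z₀ lam h)
    (hF : IsHolSemigroup F) (hf : IsSemigroupGenerator F f) (hz : z ∈ unitDisk) :
    deriv h z * f z = -lam * h z := by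
  have deriv_comp : HasDerivWithinAt (fun t => h (F t z)) (deriv h z * f z) (Ici 0) 0 :=
    (hh.hasDerivAt hz).comp_hasDerivWithinAt_of_eq 0 (hf.hasDerivWithinAt_zero hF hz)
      (hF.zero z hz).symm
  have deriv_exp : HasDerivAt (fun t : ℝ => Complex.exp (-lam * t) * h z) (-lam * h z) 0 := by
    simpa using (hasDerivAt_exp_mul_ofReal (-lam) 0).mul_const (h z)
  exact (uniqueDiffWithinAt_Ici 0).eq_deriv _ deriv_comp <| deriv_exp.hasDerivWithinAt.congr
    (fun t ht => hh.schroeder t ht z hz) (hh.schroeder 0 le_rfl z hz)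

theorem IsKoenigsFunction.invFunOn_apply (hh : IsKoenigsFunction F z₀ lam h)
    (hz : z ∈ unitDisk) : Function.invFunOn h unitDisk (h z) = z :=
  hh.univalent.leftInvOn_invFunOn hz

theorem IsKoenigsFunction.invFunOn_zero (hh : IsKoenigsFunction F z₀ lam h)
    (hz₀ : z₀ ∈ unitDisk) : Function.invFunOn h unitDisk 0 = z₀ := by
  rw [← hh.map_fixed, hh.invFunOn_apply hz₀]

theorem IsKoenigsFunction.hasDerivAt_invFunOn (hh : IsKoenigsFunction F z₀ lam h)
    (hz : z ∈ unitDisk) (hne : deriv h z ≠ 0) :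
    HasDerivAt (Function.invFunOn h unitDisk) (deriv h z)⁻¹ (h z) := by
  refine ((hh.hasStrictDerivAt hz).to_local_left_inverse hne ?_).hasDerivAt
  filter_upwards [Metric.isOpen_ball.mem_nhds hz] with x hx using hh.invFunOn_apply hx

theorem IsKoenigsFunction.map_nhds_eq (hh : IsKoenigsFunction F z₀ lam h)
    (hz₀ : z₀ ∈ unitDisk) : map h (𝓝 z₀) = 𝓝 0 := by
  rw [(hh.hasStrictDerivAt hz₀).map_nhds_eq (by rw [hh.deriv_fixed]; exact one_ne_zero),
    hh.map_fixed]

theorem IsKoenigsFunction.analyticAt_invFunOn (hh : IsKoenigsFunction F z₀ lam h)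
    (hz₀ : z₀ ∈ unitDisk) : AnalyticAt ℂ (Function.invFunOn h unitDisk) 0 := by
  have nhds_disk := Metric.isOpen_ball.mem_nhds hz₀
  have deriv_ne_zero : ∀ᶠ z in 𝓝 z₀, deriv h z ≠ 0 :=
    (hh.holomorphic.analyticAt nhds_disk).deriv.continuousAt.eventually_ne
      (by rw [hh.deriv_fixed]; exact one_ne_zero)
  rw [Complex.analyticAt_iff_eventually_differentiableAt, ← hh.map_nhds_eq hz₀, eventually_map]
  filter_upwards [nhds_disk, deriv_ne_zero] with z hz hne
  exact (hh.hasDerivAt_invFunOn hz hne).differentiableAt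

theorem IsKoenigsFunction.norm_apply_flow_le (hh : IsKoenigsFunction F z₀ lam h)
    (hre : 0 ≤ lam.re) (hz : z ∈ unitDisk) {t : ℝ} (ht : 0 ≤ t) : ‖h (F t z)‖ ≤ ‖h z‖ := by
  rw [hh.schroeder t ht z hz, norm_mul, Complex.norm_exp]
  refine mul_le_of_le_one_left (norm_nonneg _) (Real.exp_le_one_iff.mpr ?_)
  simpa using mul_nonneg hre ht

/-- Sublevel sets of `|h|` have these properties, since `|h|` decreases to `0` along orbits. -/
theorem IsKoenigsFunction.exists_absorbing_subset (hh : IsKoenigsFunction F z₀ lam h)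
    (hF : IsHolSemigroup F) (hz₀ : z₀ ∈ unitDisk) (hre : 0 < lam.re) {W : Set ℂ} (hW : W ∈ 𝓝 z₀) :
    ∃ V ⊆ W ∩ unitDisk, IsOpen V ∧ (∀ t, 0 ≤ t → MapsTo (F t) V V) ∧
      ∀ z ∈ unitDisk, ∃ t, 0 ≤ t ∧ F t z ∈ V := by
  have inv_tendsto := (hh.analyticAt_invFunOn hz₀).continuousAt.tendsto
  rw [hh.invFunOn_zero hz₀] at inv_tendsto
  obtain ⟨r, hr, ball_subset⟩ := Metric.mem_nhds_iff.mp (inv_tendsto hW)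
  refine ⟨unitDisk ∩ h ⁻¹' Metric.ball 0 r, fun z hz => ⟨?_, hz.1⟩,
    hh.holomorphic.continuousOn.isOpen_inter_preimage Metric.isOpen_ball Metric.isOpen_ball,
    fun t ht z hz => ⟨hF.mapsTo t ht hz.1, ?_⟩, fun z hz => ?_⟩
  · rw [← hh.invFunOn_apply hz.1]
    exact ball_subset hz.2
  · rw [mem_preimage, mem_ball_zero_iff]
    exact (hh.norm_apply_flow_le hre.le hz.1 ht).trans_lt (mem_ball_zero_iff.mp hz.2)
  · obtain ⟨t, ht, hmem⟩ := ((eventually_ge_atTop 0).and <|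
      (tendsto_zero_of_eq_exp_neg_mul hre fun t ht => hh.schroeder t ht z hz).eventually_mem
        (Metric.ball_mem_nhds 0 hr)).exists
    exact ⟨t, ht, hF.mapsTo t ht hz, hmem⟩

variable {A : Type*} [NormedRing A] [NormedAlgebra ℂ A] {B n : ℂ → A}

/-- The substitution `w = h(z)` turns the Euler operator `lam w d/dw` into `-f d/dz`. -/
theorem IsKoenigsFunction.fuchsResidual_apply (hh : IsKoenigsFunction F z₀ lam h)
    (hF : IsHolSemigroup F) (hf : IsSemigroupGenerator F f) (hz₀ : z₀ ∈ unitDisk)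
    (hz : z ∈ unitDisk) (hn : DifferentiableAt ℂ n (h z)) :
    fuchsResidual lam (fun w => B (Function.invFunOn h unitDisk w)) n (h z) =
      B z₀ * n (h z) - (f z • deriv (fun x => n (h x)) z + n (h z) * B z) := by
  have deriv_comp : deriv (fun x => n (h x)) z = deriv h z • deriv n (h z) :=
    (hn.hasDerivAt.scomp z (hh.hasDerivAt hz)).deriv
  rw [fuchsResidual, hh.invFunOn_zero hz₀, hh.invFunOn_apply hz, deriv_comp, smul_smul (f z),
    mul_comm (f z), hh.deriv_mul_generator hF hf hz, neg_mul, neg_smul, mul_smul]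
  abel

theorem IsKoenigsFunction.eventually_fuchsResidual_eq_zero_iff [CompleteSpace A]
    (hh : IsKoenigsFunction F z₀ lam h) (hF : IsHolSemigroup F) (hf : IsSemigroupGenerator F f)
    (hz₀ : z₀ ∈ unitDisk) (hn : AnalyticAt ℂ n 0) :
    (∀ᶠ w in 𝓝 0, fuchsResidual lam (fun w => B (Function.invFunOn h unitDisk w)) n w = 0) ↔
      ∀ᶠ z in 𝓝 z₀, f z • deriv (fun x => n (h x)) z + n (h z) * B z = B z₀ * n (h z) := by
  have differentiable_near : ∀ᶠ z in 𝓝 z₀, DifferentiableAt ℂ n (h z) := by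
    rw [← eventually_map (P := fun w => DifferentiableAt ℂ n w), hh.map_nhds_eq hz₀]
    exact Complex.analyticAt_iff_eventually_differentiableAt.mp hn
  rw [← hh.map_nhds_eq hz₀, eventually_map]
  refine eventually_congr ?_
  filter_upwards [Metric.isOpen_ball.mem_nhds hz₀, differentiable_near] with z hz hnz
  rw [hh.fuchsResidual_apply hF hf hz₀ hz hnz, sub_eq_zero, eq_comm]

theorem IsKoenigsFunction.recSolvable_iff [CompleteSpace A] (hh : IsKoenigsFunction F z₀ lam h)
    (hF : IsHolSemigroup F) (hf : IsSemigroupGenerator F f) (hz₀ : z₀ ∈ unitDisk)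
    (hlam : lam ≠ 0) (hB : AnalyticAt ℂ B z₀) :
    RecSolvable lam (B z₀) (koenigsCoeff B h) ↔ ∃ M : ℂ → A, AnalyticAt ℂ M z₀ ∧ M z₀ = 1 ∧
      ∀ᶠ z in 𝓝 z₀, f z • deriv M z + M z * B z = B z₀ * M z := by
  have inv_zero := hh.invFunOn_zero hz₀
  have inv_analytic := hh.analyticAt_invFunOn hz₀
  have recSolvable_iff :=
    recSolvable_iff_exists_analyticAt hlam (hB.comp_of_eq inv_analytic inv_zero)
  rw [Function.comp_apply, inv_zero] at recSolvable_iff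
  refine recSolvable_iff.trans ⟨?_, ?_⟩
  · rintro ⟨n, hn, hn0, residual_eq⟩
    exact ⟨fun z => n (h z), hn.comp_of_eq
      (hh.holomorphic.analyticAt (Metric.isOpen_ball.mem_nhds hz₀)) hh.map_fixed,
      (congrArg n hh.map_fixed).trans hn0,
      (hh.eventually_fuchsResidual_eq_zero_iff hF hf hz₀ hn).mp residual_eq⟩
  · rintro ⟨M, hM, hM0, heq⟩
    have hn : AnalyticAt ℂ (fun w => M (Function.invFunOn h unitDisk w)) 0 :=
      hM.comp_of_eq inv_analytic inv_zero
    have comp_eq : (fun z => M (Function.invFunOn h unitDisk (h z))) =ᶠ[𝓝 z₀] M := by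
      filter_upwards [Metric.isOpen_ball.mem_nhds hz₀] with z hz
      rw [hh.invFunOn_apply hz]
    refine ⟨_, hn, (congrArg M inv_zero).trans hM0,
      (hh.eventually_fuchsResidual_eq_zero_iff hF hf hz₀ hn).mpr ?_⟩
    filter_upwards [heq, comp_eq, comp_eq.deriv] with z hz eq_z deriv_eq
    rw [deriv_eq, eq_z, hz]

end KoenigsFunction

/-! ### Linearization -/

section ExpGroup

variable {A : Type*} [NormedRing A] [NormedAlgebra ℂ A]

/-- The one-parameter group `t ↦ e^{tC}`. -/
def expGroup (C : A) (t : ℝ) : A := NormedSpace.exp ((t : ℂ) • C)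

theorem expGroup_zero (C : A) : expGroup C 0 = 1 := by
  simp [expGroup]

variable [CompleteSpace A]

theorem expGroup_add (C : A) (s t : ℝ) : expGroup C (s + t) = expGroup C s * expGroup C t := by
  let _ : NormedAlgebra ℚ A := NormedAlgebra.restrictScalars ℚ ℂ A
  rw [expGroup, Complex.ofReal_add, add_smul]
  exact NormedSpace.exp_add_of_commute (((Commute.refl C).smul_left _).smul_right _)

theorem expGroup_mul_neg (C : A) (t : ℝ) : expGroup C t * expGroup C (-t) = 1 := by
  rw [← expGroup_add, add_neg_cancel, expGroup_zero]

theorem isUnit_expGroup (C : A) (t : ℝ) : IsUnit (expGroup C t) := by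
  let _ : NormedAlgebra ℚ A := NormedAlgebra.restrictScalars ℚ ℂ A
  exact NormedSpace.isUnit_exp _

theorem hasDerivAt_expGroup (C : A) (t : ℝ) :
    HasDerivAt (expGroup C) (expGroup C t * C) t := by
  have deriv_comp := (hasDerivAt_exp_smul_const C (t : ℂ)).scomp t Complex.ofRealCLM.hasDerivAt
  rwa [Complex.ofRealCLM_apply, Complex.ofReal_one, one_smul] at deriv_comp

theorem hasDerivAt_expGroup_neg (C : A) (t : ℝ) :
    HasDerivAt (fun s => expGroup C (-s)) (-(expGroup C (-t) * C)) t := by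
  have deriv_comp := (hasDerivAt_expGroup C (-t)).scomp t (hasDerivAt_neg t)
  rwa [neg_one_smul] at deriv_comp

end ExpGroup

section Semicocycle

variable {A : Type*} [NormedRing A] [NormedAlgebra ℂ A] {F : ℝ → ℂ → ℂ} {f : ℂ → ℂ}
  {Γ : ℝ → ℂ → A} {B M : ℂ → A} {C : A} {V : Set ℂ} {z : ℂ}

theorem IsSemicocycle.isUnit_nat_mul (hΓ : IsSemicocycle F Γ)
    (hz : z ∈ unitDisk) {ε : ℝ} (hε : 0 ≤ ε) (n : ℕ)
    (hunit : ∀ j < n, IsUnit (Γ ε (F (j * ε) z))) : IsUnit (Γ (n * ε) z) := by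
  induction n with
  | zero => simp [hΓ.zero z hz]
  | succ n ih =>
    have split : Γ ((n + 1 : ℕ) * ε) z = Γ ε (F (n * ε) z) * Γ (n * ε) z := by
      rw [hΓ.chain ε (n * ε) hε (by positivity) z hz]
      push_cast
      ring_nf
    rw [split]
    exact (hunit n n.lt_succ_self).mul (ih fun j hj => hunit j (hj.trans n.lt_succ_self))

theorem IsSemicocycle.eventually_isUnit [CompleteSpace A] (hF : IsHolSemigroup F)
    (hΓ : IsSemicocycle F Γ) (hz : z ∈ unitDisk) (t : ℝ) :
    ∀ᶠ ε in 𝓝 (0 : ℝ), ∀ s ∈ Icc 0 t, 0 ≤ ε → IsUnit (Γ ε (F s z)) := by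
  suffices ∀ᶠ ε in 𝓝 (0 : ℝ), ∀ s ∈ Icc 0 t, 0 ≤ s → 0 ≤ ε → IsUnit (Γ ε (F s z)) from
    this.mono fun ε h s hs => h s hs hs.1
  refine isCompact_Icc.eventually_forall_of_forall_eventually fun s hs => ?_
  have cont : ContinuousOn (fun p : ℝ × ℝ => Γ p.1 (F p.2 z)) (Ici 0 ×ˢ Ici 0) :=
    hΓ.continuous.comp (f := fun p : ℝ × ℝ => (p.1, F p.2 z))
      (continuousOn_fst.prodMk ((hF.continuousOn_orbit hz).comp continuousOn_snd
        fun p hp => hp.2)) fun p hp => ⟨hp.1, hF.mapsTo _ hp.2 hz⟩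
  have nhds_unit : {a : A | IsUnit a} ∈ 𝓝 (Γ 0 (F s z)) := by
    rw [hΓ.zero _ (hF.mapsTo s hs.1 hz)]
    exact Units.isOpen.mem_nhds isUnit_one
  filter_upwards [eventually_nhdsWithin_iff.mp
    ((cont (0, s) ⟨self_mem_Ici, hs.1⟩).eventually_mem nhds_unit)] with p hp hp2 hp1
  exact hp ⟨hp1, hp2⟩

theorem IsSemicocycle.isUnit [CompleteSpace A] (hF : IsHolSemigroup F) (hΓ : IsSemicocycle F Γ)
    {t : ℝ} (ht : 0 ≤ t) (hz : z ∈ unitDisk) : IsUnit (Γ t z) := by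
  obtain ⟨n, hunit, hn⟩ := ((tendsto_const_div_atTop_nhds_zero_nat t).eventually
    (hΓ.eventually_isUnit hF hz t) |>.and (eventually_gt_atTop 0)).exists
  have hn' : (0 : ℝ) < n := Nat.cast_pos.mpr hn
  have hε : 0 ≤ t / n := by positivity
  have unit_mul := hΓ.isUnit_nat_mul hz hε n fun j hj => hunit _ ⟨by positivity, ?_⟩ hε
  · rwa [mul_div_cancel₀ t hn'.ne'] at unit_mul
  · calc j * (t / n) ≤ n * (t / n) := by gcongr
      _ = t := mul_div_cancel₀ t hn'.ne'

/-- The identity `M(F_t) Γ_t = e^{tC} M` on `V`. For `V` the whole disk and `M` invertible this is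
linearizability; a neighbourhood `V` of the fixed point gives a local form of it. -/
def Intertwines (F : ℝ → ℂ → ℂ) (Γ : ℝ → ℂ → A) (C : A) (M : ℂ → A) (V : Set ℂ) : Prop :=
  ∀ t : ℝ, 0 ≤ t → ∀ z ∈ V, M (F t z) * Γ t z = expGroup C t * M z

theorem isLinearizable_iff_exists_intertwines (hF : IsHolSemigroup F) :
    IsLinearizable F Γ ↔ ∃ (C : A) (M : ℂ → A), DifferentiableOn ℂ M unitDisk ∧
      (∀ z ∈ unitDisk, IsUnit (M z)) ∧ Intertwines F Γ C M unitDisk := by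
  refine exists_congr fun C => exists_congr fun M => and_congr_right fun _ =>
    and_congr_right fun hM => forall₄_congr fun t ht z hz => ?_
  rw [mul_assoc, eq_comm,
    Ring.inverse_mul_eq_iff_eq_mul _ _ _ (hM _ (hF.mapsTo t ht hz)), eq_comm, expGroup]

theorem IsSemicocycleGeneratedBy.hasDerivWithinAt_mul (hF : IsHolSemigroup F)
    (hf : IsSemigroupGenerator F f) (hΓB : IsSemicocycleGeneratedBy F Γ B) (hz : z ∈ unitDisk)
    {t : ℝ} (ht : 0 ≤ t) (hM : DifferentiableAt ℂ M (F t z)) :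
    HasDerivWithinAt (fun s => M (F s z) * Γ s z)
      ((f (F t z) • deriv M (F t z) + M (F t z) * B (F t z)) * Γ t z) (Ici t) t := by
  have deriv_comp : HasDerivWithinAt (fun s => M (F s z)) (f (F t z) • deriv M (F t z)) (Ici t) t :=
    hM.hasDerivAt.scomp_hasDerivWithinAt t (hf.hasDerivWithinAt_orbit hF hz ht)
  refine (deriv_comp.mul (((hΓB z hz).2 t ht).mono (Ici_subset_Ici.mpr ht))).congr_deriv ?_
  rw [add_mul, mul_assoc (M _)]

theorem IsSemicocycleGeneratedBy.intertwines_of_deriv [CompleteSpace A] (hF : IsHolSemigroup F)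
    (hf : IsSemigroupGenerator F f) (hΓB : IsSemicocycleGeneratedBy F Γ B) (hV : V ⊆ unitDisk)
    (hVF : ∀ t, 0 ≤ t → MapsTo (F t) V V) (hM : ∀ z ∈ V, DifferentiableAt ℂ M z)
    (heq : ∀ z ∈ V, f z • deriv M z + M z * B z = C * M z) : Intertwines F Γ C M V := by
  intro t ht z hz
  have hzD := hV hz
  have cont_mul : ContinuousOn (fun s => M (F s z) * Γ s z) (Icc 0 t) :=
    ContinuousOn.mul
      (ContinuousOn.comp (fun w hw => (hM w hw).continuousAt.continuousWithinAt)
        ((hF.continuousOn_orbit hzD).mono Icc_subset_Ici_self) fun s hs => hVF s hs.1 hz)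
      fun s hs => ((hΓB z hzD).2 s hs.1).continuousWithinAt.mono Icc_subset_Ici_self
  have exp_mul_const := constant_of_has_deriv_right_zero (a := 0) (b := t)
    (f := fun s : ℝ => expGroup C (-s) * (M (F s z) * Γ s z))
    (ContinuousOn.mul
      (fun s _ => (hasDerivAt_expGroup_neg C s).continuousAt.continuousWithinAt) cont_mul)
    (fun s hs => by
      have hw := hVF s hs.1 hz
      refine ((hasDerivAt_expGroup_neg C s).hasDerivWithinAt.mul
        (hΓB.hasDerivWithinAt_mul hF hf hzD hs.1 (hM _ hw))).congr_deriv ?_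
      rw [heq _ hw]
      noncomm_ring)
    t (right_mem_Icc.mpr ht)
  simp only [neg_zero, expGroup_zero, one_mul, hF.zero z hzD, (hΓB z hzD).1, mul_one]
    at exp_mul_const
  rw [← exp_mul_const, ← mul_assoc, expGroup_mul_neg, one_mul]

theorem IsSemicocycleGeneratedBy.deriv_of_intertwines [CompleteSpace A] (hF : IsHolSemigroup F)
    (hf : IsSemigroupGenerator F f) (hΓB : IsSemicocycleGeneratedBy F Γ B)
    (hint : Intertwines F Γ C M V) (hzD : z ∈ unitDisk) (hz : z ∈ V)
    (hM : DifferentiableAt ℂ M z) : f z • deriv M z + M z * B z = C * M z := by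
  have deriv_left := hΓB.hasDerivWithinAt_mul hF hf hzD le_rfl ((hF.zero z hzD).symm ▸ hM)
  have deriv_right : HasDerivWithinAt (fun s => expGroup C s * M z) (C * M z) (Ici 0) 0 := by
    simpa [expGroup_zero] using ((hasDerivAt_expGroup C 0).mul_const (M z)).hasDerivWithinAt
  have deriv_eq := (uniqueDiffWithinAt_Ici (0 : ℝ)).eq_deriv _ deriv_left <|
    deriv_right.congr (fun t ht => hint t ht z hz) (hint 0 le_rfl z hz)
  rwa [hF.zero z hzD, (hΓB z hzD).1, mul_one] at deriv_eq

/-- The function `e^{-tC} M(F_t) Γ_t`, which spreads a local solution `M` to the points that reach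
its domain at time `t`. -/
def flowPullback (F : ℝ → ℂ → ℂ) (Γ : ℝ → ℂ → A) (C : A) (M : ℂ → A) (t : ℝ) (z : ℂ) : A :=
  expGroup C (-t) * (M (F t z) * Γ t z)

theorem IsSemicocycle.differentiableAt_flowPullback (hF : IsHolSemigroup F)
    (hΓ : IsSemicocycle F Γ) (C : A) (hz : z ∈ unitDisk) {t : ℝ} (ht : 0 ≤ t)
    (hM : DifferentiableAt ℂ M (F t z)) : DifferentiableAt ℂ (flowPullback F Γ C M t) z := by
  have nhds_disk := Metric.isOpen_ball.mem_nhds hz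
  exact ((hM.comp z ((hF.holomorphic t ht).differentiableAt nhds_disk)).mul
    ((hΓ.holomorphic t ht).differentiableAt nhds_disk)).const_mul _

section Extension

variable [CompleteSpace A]

theorem Intertwines.flowPullback_eq (hint : Intertwines F Γ C M V) {t : ℝ} (ht : 0 ≤ t)
    (hz : z ∈ V) : flowPullback F Γ C M t z = M z := by
  rw [flowPullback, hint t ht z hz, ← mul_assoc, ← expGroup_add, neg_add_cancel, expGroup_zero,
    one_mul]

theorem IsSemicocycle.expGroup_mul_flowPullback_add (hF : IsHolSemigroup F)
    (hΓ : IsSemicocycle F Γ) (C : A) (M : ℂ → A) (hz : z ∈ unitDisk) {s t : ℝ} (hs : 0 ≤ s)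
    (ht : 0 ≤ t) :
    expGroup C t * flowPullback F Γ C M (s + t) z = flowPullback F Γ C M s (F t z) * Γ t z := by
  have exp_eq : expGroup C t * expGroup C (-(s + t)) = expGroup C (-s) := by
    rw [← expGroup_add]
    ring_nf
  rw [flowPullback, flowPullback, ← mul_assoc, exp_eq, hF.add s t hs ht z hz,
    ← hΓ.chain s t hs ht z hz]
  noncomm_ring

theorem Intertwines.flowPullback_add (hF : IsHolSemigroup F) (hΓ : IsSemicocycle F Γ)
    (hint : Intertwines F Γ C M V) (hz : z ∈ unitDisk) {s t : ℝ} (hs : 0 ≤ s) (ht : 0 ≤ t)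
    (hV : F t z ∈ V) : flowPullback F Γ C M (s + t) z = flowPullback F Γ C M t z := by
  refine (isUnit_expGroup C t).mul_left_cancel ?_
  rw [hΓ.expGroup_mul_flowPullback_add hF C M hz hs ht, hint.flowPullback_eq hs hV, flowPullback,
    ← mul_assoc, expGroup_mul_neg, one_mul]

theorem Intertwines.flowPullback_congr (hF : IsHolSemigroup F) (hΓ : IsSemicocycle F Γ)
    (hint : Intertwines F Γ C M V) (hz : z ∈ unitDisk) {s t : ℝ} (hs : 0 ≤ s) (ht : 0 ≤ t)
    (hVs : F s z ∈ V) (hVt : F t z ∈ V) :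
    flowPullback F Γ C M s z = flowPullback F Γ C M t z := by
  rw [← hint.flowPullback_add hF hΓ hz hs ht hVt, add_comm,
    hint.flowPullback_add hF hΓ hz ht hs hVs]

theorem IsSemicocycle.isUnit_flowPullback (hF : IsHolSemigroup F) (hΓ : IsSemicocycle F Γ) (C : A)
    (hz : z ∈ unitDisk) {t : ℝ} (ht : 0 ≤ t) (hM : IsUnit (M (F t z))) :
    IsUnit (flowPullback F Γ C M t z) :=
  (isUnit_expGroup C _).mul (hM.mul (hΓ.isUnit hF ht hz))

theorem IsSemicocycle.isLinearizable_of_intertwines (hF : IsHolSemigroup F)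
    (hΓ : IsSemicocycle F Γ) (hVo : IsOpen V) (habs : ∀ z ∈ unitDisk, ∃ t, 0 ≤ t ∧ F t z ∈ V)
    (hM : ∀ z ∈ V, DifferentiableAt ℂ M z) (hunit : ∀ z ∈ V, IsUnit (M z))
    (hint : Intertwines F Γ C M V) : IsLinearizable F Γ := by
  choose! T hT hTV using habs
  rw [isLinearizable_iff_exists_intertwines hF]
  refine ⟨C, fun z => flowPullback F Γ C M (T z) z, fun z hz => ?_, fun z hz =>
    hΓ.isUnit_flowPullback hF C hz (hT z hz) (hunit _ (hTV z hz)), fun t ht z hz => ?_⟩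
  · have locally_eq : (fun w => flowPullback F Γ C M (T w) w) =ᶠ[𝓝 z]
        flowPullback F Γ C M (T z) := by
      have nhds_disk := Metric.isOpen_ball.mem_nhds hz
      filter_upwards [nhds_disk, ((hF.holomorphic _ (hT z hz)).continuousOn.continuousAt
        nhds_disk).eventually_mem (hVo.mem_nhds (hTV z hz))] with w hw hwV
      exact hint.flowPullback_congr hF hΓ hw (hT w hw) (hT z hz) (hTV w hw) hwV
    exact (locally_eq.differentiableAt_iff.mpr (hΓ.differentiableAt_flowPullback hF C hz (hT z hz)
      (hM _ (hTV z hz)))).differentiableWithinAt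
  · have hw := hF.mapsTo t ht hz
    have entry : F (T (F t z) + t) z ∈ V := by
      rw [hF.add _ _ (hT _ hw) ht z hz]
      exact hTV _ hw
    rw [← hΓ.expGroup_mul_flowPullback_add hF C M hz (hT _ hw) ht,
      hint.flowPullback_congr hF hΓ hz (add_nonneg (hT _ hw) ht) (hT z hz) entry (hTV z hz)]

end Extension

theorem exists_normalized_solution {z₀ : ℂ} (hf0 : f z₀ = 0) {U : Set ℂ} (hU : IsOpen U)
    (hz₀ : z₀ ∈ U) (hM : DifferentiableOn ℂ M U) (hunit : IsUnit (M z₀))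
    (heq : ∀ z ∈ U, f z • deriv M z + M z * B z = C * M z) :
    ∃ N : ℂ → A, DifferentiableOn ℂ N U ∧ N z₀ = 1 ∧
      ∀ z ∈ U, f z • deriv N z + N z * B z = B z₀ * N z := by
  obtain ⟨u, hu⟩ := hunit
  have conj_eq : (↑u⁻¹ : A) * C = B z₀ * ↑u⁻¹ := by
    have at_fixed := heq z₀ hz₀
    rw [hf0, zero_smul, zero_add, ← hu] at at_fixed
    rw [Units.inv_mul_eq_iff_eq_mul, ← mul_assoc, at_fixed, mul_assoc, Units.mul_inv, mul_one]
  refine ⟨fun z => ↑u⁻¹ * M z, hM.const_mul _, by simp only [← hu, Units.inv_mul], fun z hz => ?_⟩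
  rw [((hM.hasDerivAt (hU.mem_nhds hz)).const_mul (↑u⁻¹ : A)).deriv, ← mul_smul_comm, mul_assoc,
    ← mul_add, heq z hz, ← mul_assoc, conj_eq, mul_assoc]

variable [CompleteSpace A] {h : ℂ → ℂ} {z₀ lam : ℂ}

theorem recSolvable_of_isLinearizable (hF : IsHolSemigroup F) (hf : IsSemigroupGenerator F f)
    (hz₀ : z₀ ∈ unitDisk) (hf0 : f z₀ = 0) (hlam : lam ≠ 0) (hB : DifferentiableOn ℂ B unitDisk)
    (hh : IsKoenigsFunction F z₀ lam h) (hΓB : IsSemicocycleGeneratedBy F Γ B)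
    (hlin : IsLinearizable F Γ) : RecSolvable lam (B z₀) (koenigsCoeff B h) := by
  have nhds_disk := Metric.isOpen_ball.mem_nhds hz₀
  obtain ⟨C, M, hM, hunit, hint⟩ := (isLinearizable_iff_exists_intertwines hF).mp hlin
  obtain ⟨N, hN, hN0, heq⟩ := exists_normalized_solution hf0 Metric.isOpen_ball hz₀ hM
    (hunit z₀ hz₀) fun z hz => hΓB.deriv_of_intertwines hF hf hint hz hz
      (hM.differentiableAt (Metric.isOpen_ball.mem_nhds hz))
  exact (hh.recSolvable_iff hF hf hz₀ hlam (hB.analyticAt nhds_disk)).mpr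
    ⟨N, hN.analyticAt nhds_disk, hN0, eventually_of_mem nhds_disk heq⟩

theorem isLinearizable_of_recSolvable (hF : IsHolSemigroup F) (hf : IsSemigroupGenerator F f)
    (hz₀ : z₀ ∈ unitDisk) (hre : 0 < lam.re) (hB : AnalyticAt ℂ B z₀)
    (hh : IsKoenigsFunction F z₀ lam h) (hΓ : IsSemicocycle F Γ)
    (hΓB : IsSemicocycleGeneratedBy F Γ B) (hrec : RecSolvable lam (B z₀) (koenigsCoeff B h)) :
    IsLinearizable F Γ := by
  have hlam : lam ≠ 0 := fun h => by simp [h] at hre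
  obtain ⟨M, hM, hM0, heq⟩ := (hh.recSolvable_iff hF hf hz₀ hlam hB).mp hrec
  have unit_near : ∀ᶠ z in 𝓝 z₀, IsUnit (M z) :=
    hM.continuousAt.eventually_mem (Units.isOpen.mem_nhds (by rw [hM0]; exact isUnit_one))
  obtain ⟨V, hVW, hVo, hVF, habs⟩ := hh.exists_absorbing_subset hF hz₀ hre
    ((Complex.analyticAt_iff_eventually_differentiableAt.mp hM).and (unit_near.and heq))
  have hint : Intertwines F Γ (B z₀) M V := hΓB.intertwines_of_deriv hF hf
    (fun z hz => (hVW hz).2) hVF (fun z hz => (hVW hz).1.1) fun z hz => (hVW hz).1.2.2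
  exact hΓ.isLinearizable_of_intertwines hF hVo habs (fun z hz => (hVW hz).1.1)
    (fun z hz => (hVW hz).1.2.1) hint

end Semicocycle

end

theorem proposition3p8 {A : Type*} [NormedRing A] [NormOneClass A] [NormedAlgebra ℂ A]
    [CompleteSpace A]
    (F : ℝ → ℂ → ℂ) (hF : IsHolSemigroup F)
    (f : ℂ → ℂ) (hf : IsSemigroupGenerator F f)
    (z₀ : ℂ) (hz₀ : z₀ ∈ unitDisk) (hfz₀ : f z₀ = 0)
    (lam : ℂ) (hlam : lam = -deriv f z₀) (hre : 0 < lam.re)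
    (B : ℂ → A) (hB : DifferentiableOn ℂ B unitDisk) :
    (∃ h : ℂ → ℂ, IsKoenigsFunction F z₀ lam h) ∧
    ∀ h : ℂ → ℂ, IsKoenigsFunction F z₀ lam h →
      ∀ Γ : ℝ → ℂ → A, IsSemicocycle F Γ → IsSemicocycleGeneratedBy F Γ B →
        (IsLinearizable F Γ ↔ RecSolvable lam (B z₀) (koenigsCoeff B h)) := by
  have hlam0 : lam ≠ 0 := fun h => by simp [h] at hre
  exact ⟨hf.exists_isKoenigsFunction hF hz₀ hfz₀ hlam hre, fun h hh Γ hΓ hΓB =>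
    ⟨recSolvable_of_isLinearizable hF hf hz₀ hfz₀ hlam0 hB hh hΓB,
      isLinearizable_of_recSolvable hF hf hz₀ hre
        (hB.analyticAt (Metric.isOpen_ball.mem_nhds hz₀)) hh hΓ hΓB⟩⟩
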